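/- Let $t_f>0$, $n,m\in\mathbb{N}$, $A\in\mathbb{R}^{n\times n}$, $B\in\mathbb{R}^{n\times m}$, $f\in L^2([0,t_f],\mathbb{R}^n)$, $x^0\in\mathbb{R}^n$ and $\alpha>0$. Let $\ell_x:\mathbb{R}^n\to[0,\infty)$ be continuous and convex, such that $\ell_x\circ x\in L^1([0,t_f],\mathbb{R})$ for every $x\in L^2([0,t_f],\mathbb{R}^n)$ and such that $x\mapsto\int_0^{t_f}\ell_x(x(\tau))\,\mathrm{d}\tau$ is Fréchet differentiable on $L^2([0,t_f],\mathbb{R}^n)$. Define \[ J:L^2([0,t_f],\mathbb{R}^n)\times L^2([0,t_f],\mathbb{R}^m)\to\mathbb{R},\qquad J(x,u)=\int_0^{t_f}\ell_x(x(\tau))+\tfrac{\alpha}{2}\|u(\tau)\|^2\,\mathrm{d}\tau , \] denote by $\nabla_xJ$, $\nabla_uJ$ its $L^2$-gradients, and let $\mathcal{C}$ be the unbounded linear operator \[ \mathcal{C}:L^2([0,t_f],\mathbb{R}^n\times\mathbb{R}^m)\supset D(\mathcal{C})\to L^2([0,t_f],\mathbb{R}^n)\times\mathbb{R}^n,\qquad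 \mathcal{C}\begin{bmatrix}x\\u\end{bmatrix}=\begin{bmatrix}\tfrac{\mathrm{d}}{\mathrm{d}\tau}x-Ax-Bu\\ x(0)\end{bmatrix}, \] with domain $D(\mathcal{C})=H^1([0,t_f],\mathbb{R}^n)\times L^2([0,t_f],\mathbb{R}^m)$, and let $\mathcal{C}^*$ with domain $D(\mathcal{C}^*)\subset L^2([0,t_f],\mathbb{R}^n)\times\mathbb{R}^n$ be its Hilbert space adjoint. Then the following hold. (1) The optimal control problem \[ \min_{(x,u)\in H^1([0,t_f],\mathbb{R}^n)\times L^2([0,t_f],\mathbb{R}^m)}J(x,u)\quad\text{subject to}\quad \mathcal{C}\begin{bmatrix}x\\u\end{bmatrix}=\begin{bmatrix}f\\x^0\end{bmatrix} \] (that is, $\dot x=Ax+Bu+f$, $x(0)=x^0$) has a unique optimal solution $(\hat x,\hat u)\in D(\mathcal{C})$. (2) There exists a Lagrange multiplier $(\hat\lambda,\hat\lambda_0)\in D(\mathcal{C}^*)$ such that \[ M_{\mathrm{opt}}(\hat x,\hat u,(\hat\lambda,\hat\lambda_0)):=\begin{bmatrix}\begin{bmatrix}\nabla_xJ(\hat x,\hat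 u)\\ \nabla_uJ(\hat x,\hat u)\end{bmatrix}-\mathcal{C}^*\begin{bmatrix}\hat\lambda\\ \hat\lambda_0\end{bmatrix}\\[2ex] \mathcal{C}\begin{bmatrix}\hat x\\ \hat u\end{bmatrix}\end{bmatrix}=\begin{bmatrix}0\\0\\ \begin{bmatrix}f\\x^0\end{bmatrix}\end{bmatrix}. \] (3) The operator $M_{\mathrm{opt}}:D(\mathcal{C})\times D(\mathcal{C}^*)\to X:=L^2([0,t_f],\mathbb{R}^n\times\mathbb{R}^m\times\mathbb{R}^n)\times\mathbb{R}^n$ is bijective and m-accretive, i.e. $\langle M_{\mathrm{opt}}(z_1)-M_{\mathrm{opt}}(z_2),z_1-z_2\rangle_X\ge 0$ for all $z_1,z_2\in D(\mathcal{C})\times D(\mathcal{C}^*)$, and $\operatorname{ran}(\mu I+M_{\mathrm{opt}})=X$ for every $\mu>0$. In particular, the solution $(\hat x,\hat u,(\hat\lambda,\hat\lambda_0))$ of the system in (2) is unique. -/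

import Mathlib

open MeasureTheory Set
open scoped ContDiff InnerProductSpace

noncomputable section

namespace OptCtrl

/-! ## The function spaces `L²([0,T], ℝᵏ)` and `H¹([0,T], ℝᵏ)` -/

/-- `ℝᵏ` with the Euclidean norm. -/
abbrev E (k : ℕ) : Type := EuclideanSpace ℝ (Fin k)

/-- Lebesgue measure on `[0,T]`. -/
abbrev vol (T : ℝ) : Measure ℝ := volume.restrict (Icc 0 T)

/-- The Hilbert space `L²([0,T], ℝᵏ)`. -/
abbrev L2 (T : ℝ) (k : ℕ) : Type := Lp (E k) 2 (vol T)

/-- Smooth real test functions with compact support in the open interval `(0,T)`. -/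
def IsTest (T : ℝ) (φ : ℝ → ℝ) : Prop :=
  ContDiff ℝ ∞ φ ∧ HasCompactSupport φ ∧ tsupport φ ⊆ Ioo 0 T

/-- `g` is the weak derivative of `x` on `(0,T)`. -/
def HasWeakDeriv {T : ℝ} {k : ℕ} (x g : L2 T k) : Prop :=
  ∀ φ : ℝ → ℝ, IsTest T φ → ∫ t in Icc 0 T, deriv φ t • x t = -∫ t in Icc 0 T, φ t • g t

theorem IsTest.zero_of_notMem {T : ℝ} {φ : ℝ → ℝ} (h : IsTest T φ) {t : ℝ} (ht : t ∉ Ioo 0 T) :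
    φ t = 0 :=
  image_eq_zero_of_notMem_tsupport fun h' => ht (h.2.2 h')

theorem IsTest.continuous {T : ℝ} {φ : ℝ → ℝ} (h : IsTest T φ) : Continuous φ := h.1.continuous

theorem IsTest.continuous_deriv {T : ℝ} {φ : ℝ → ℝ} (h : IsTest T φ) : Continuous (deriv φ) :=
  h.1.continuous_deriv (by simp)

theorem integrableOn_smul {T : ℝ} {k : ℕ} {φ : ℝ → ℝ} (hφ : Continuous φ)
    {y : ℝ → E k} (hy : IntegrableOn y (Icc 0 T)) :
    IntegrableOn (fun t => φ t • y t) (Icc 0 T) :=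
  hy.continuousOn_smul hφ.continuousOn isCompact_Icc

theorem integrableOn_L2 {T : ℝ} {k : ℕ} (x : L2 T k) : IntegrableOn x (Icc 0 T) :=
  (Lp.memLp x).integrable (by norm_num)

/-- The fundamental lemma: an integrable function whose product with every test function has
integral zero vanishes. -/
theorem ae_zero_of_test {T : ℝ} {k : ℕ} {y : ℝ → E k} (hy : IntegrableOn y (Icc 0 T))
    (h : ∀ φ : ℝ → ℝ, IsTest T φ → ∫ t in Icc 0 T, φ t • y t = 0) : y =ᵐ[vol T] 0 := by
  have key := isOpen_Ioo.ae_eq_zero_of_integral_contDiff_smul_eq_zero (μ := volume)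
    (U := Ioo 0 T) (f := y) (hy.mono_set Ioo_subset_Icc_self).locallyIntegrableOn
    (fun φ h1 h2 h3 => by
      have ht : IsTest T φ := ⟨h1, h2, h3⟩
      rw [← h φ ht, setIntegral_eq_integral_of_forall_compl_eq_zero]
      intro t htt
      rw [ht.zero_of_notMem fun h' => htt (Ioo_subset_Icc_self h'), zero_smul])
  have : vol T = volume.restrict (Ioo 0 T) :=
    (Measure.restrict_congr_set (Ioo_ae_eq_Icc (μ := volume) (a := (0 : ℝ)) (b := T))).symm
  rw [this]
  exact (ae_restrict_iff' measurableSet_Ioo).2 key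

theorem HasWeakDeriv.unique {T : ℝ} {k : ℕ} {x g g' : L2 T k} (h : HasWeakDeriv x g)
    (h' : HasWeakDeriv x g') : g = g' := by
  have : (fun t => g t - g' t) =ᵐ[vol T] 0 := by
    refine ae_zero_of_test ((integrableOn_L2 g).sub (integrableOn_L2 g')) fun φ hφ => ?_
    simp only [smul_sub]
    rw [integral_sub (integrableOn_smul hφ.continuous (integrableOn_L2 g))
      (integrableOn_smul hφ.continuous (integrableOn_L2 g')), sub_eq_zero]
    exact neg_injective ((h φ hφ).symm.trans (h' φ hφ))
  refine Lp.ext ?_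
  filter_upwards [this] with t ht
  exact sub_eq_zero.1 ht

theorem HasWeakDeriv.add {T : ℝ} {k : ℕ} {x y g h : L2 T k} (hx : HasWeakDeriv x g)
    (hy : HasWeakDeriv y h) : HasWeakDeriv (x + y) (g + h) := by
  intro φ hφ
  have e1 : ∫ t in Icc 0 T, deriv φ t • (x + y : L2 T k) t
      = ∫ t in Icc 0 T, (deriv φ t • x t + deriv φ t • y t) := by
    refine integral_congr_ae ?_
    filter_upwards [Lp.coeFn_add x y] with t ht
    rw [ht, Pi.add_apply, smul_add]
  have e2 : ∫ t in Icc 0 T, φ t • (g + h : L2 T k) t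
      = ∫ t in Icc 0 T, (φ t • g t + φ t • h t) := by
    refine integral_congr_ae ?_
    filter_upwards [Lp.coeFn_add g h] with t ht
    rw [ht, Pi.add_apply, smul_add]
  rw [e1, e2, integral_add (integrableOn_smul hφ.continuous_deriv (integrableOn_L2 x))
    (integrableOn_smul hφ.continuous_deriv (integrableOn_L2 y)),
    integral_add (integrableOn_smul hφ.continuous (integrableOn_L2 g))
    (integrableOn_smul hφ.continuous (integrableOn_L2 h)), hx φ hφ, hy φ hφ, neg_add]

theorem HasWeakDeriv.smul {T : ℝ} {k : ℕ} (c : ℝ) {x g : L2 T k} (hx : HasWeakDeriv x g) :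
    HasWeakDeriv (c • x) (c • g) := by
  intro φ hφ
  have e1 : ∫ t in Icc 0 T, deriv φ t • (c • x : L2 T k) t
      = ∫ t in Icc 0 T, c • (deriv φ t • x t) := by
    refine integral_congr_ae ?_
    filter_upwards [Lp.coeFn_smul c x] with t ht
    rw [ht, Pi.smul_apply, smul_comm]
  have e2 : ∫ t in Icc 0 T, φ t • (c • g : L2 T k) t = ∫ t in Icc 0 T, c • (φ t • g t) := by
    refine integral_congr_ae ?_
    filter_upwards [Lp.coeFn_smul c g] with t ht
    rw [ht, Pi.smul_apply, smul_comm]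
  rw [e1, e2, integral_smul, integral_smul, hx φ hφ, smul_neg]

theorem HasWeakDeriv.zero {T : ℝ} {k : ℕ} : HasWeakDeriv (0 : L2 T k) 0 := by
  have e : ∀ φ : ℝ → ℝ, ∫ t in Icc 0 T, φ t • (0 : L2 T k) t = 0 := fun φ => by
    rw [← integral_zero ℝ (E k) (μ := vol T)]
    refine integral_congr_ae ?_
    filter_upwards [Lp.coeFn_zero (E k) 2 (vol T)] with t ht
    rw [ht, Pi.zero_apply, smul_zero]
  intro φ _
  rw [e, e, neg_zero]

/-- The Sobolev space `H¹([0,T], ℝᵏ)`: the `L²` functions with a weak derivative in `L²`. -/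
def H1 (T : ℝ) (k : ℕ) : Submodule ℝ (L2 T k) where
  carrier := {x | ∃ g, HasWeakDeriv x g}
  add_mem' := fun ⟨g, hg⟩ ⟨h, hh⟩ => ⟨g + h, hg.add hh⟩
  zero_mem' := ⟨0, HasWeakDeriv.zero⟩
  smul_mem' := fun c _ ⟨g, hg⟩ => ⟨c • g, hg.smul c⟩

theorem hasWeakDeriv_choose {T : ℝ} {k : ℕ} (x : H1 T k) :
    HasWeakDeriv (x : L2 T k) x.2.choose := x.2.choose_spec

/-- The weak derivative `d/dτ : H¹ → L²`. -/
def weakDeriv (T : ℝ) (k : ℕ) : H1 T k →ₗ[ℝ] L2 T k where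
  toFun x := x.2.choose
  map_add' x y :=
    (hasWeakDeriv_choose (x + y)).unique ((hasWeakDeriv_choose x).add (hasWeakDeriv_choose y))
  map_smul' c x := (hasWeakDeriv_choose (c • x)).unique ((hasWeakDeriv_choose x).smul c)

theorem hasWeakDeriv_weakDeriv {T : ℝ} {k : ℕ} (x : H1 T k) :
    HasWeakDeriv (x : L2 T k) (weakDeriv T k x) := x.2.choose_spec

/-! ### Continuous representatives and the value at `0` -/

/-- `ξ` is a continuous representative of `x` on `[0,T]`. -/
def IsContRep {T : ℝ} {k : ℕ} (x : L2 T k) (ξ : ℝ → E k) : Prop :=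
  ContinuousOn ξ (Icc 0 T) ∧ x =ᵐ[vol T] ξ

theorem IsContRep.eqOn {T : ℝ} (hT : 0 < T) {k : ℕ} {x : L2 T k} {ξ η : ℝ → E k}
    (h : IsContRep x ξ) (h' : IsContRep x η) : EqOn ξ η (Icc 0 T) :=
  Measure.eqOn_Icc_of_ae_eq volume hT.ne (h.2.symm.trans h'.2) h.1 h'.1

/-- Integration by parts against a test function for a primitive. -/
theorem integral_deriv_smul_primitive {T : ℝ} (hT : 0 < T) {k : ℕ} {g : ℝ → E k}
    (hg : IntegrableOn g (Icc 0 T)) {φ : ℝ → ℝ} (hφ : IsTest T φ) :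
    ∫ t in Icc 0 T, deriv φ t • (∫ s in (0 : ℝ)..t, g s) = -∫ t in Icc 0 T, φ t • g t := by
  have hgI : IntervalIntegrable g volume 0 T :=
    (intervalIntegrable_iff_integrableOn_Icc_of_le hT.le).2 hg
  have hGc : ContinuousOn (fun t => ∫ s in (0 : ℝ)..t, g s) (Icc 0 T) := by
    have := intervalIntegral.continuousOn_primitive_interval (μ := volume) (a := 0) (b := T)
      (f := g) (by rwa [uIcc_of_le hT.le])
    rwa [uIcc_of_le hT.le] at this
  have i1 : IntegrableOn (fun t => deriv φ t • (∫ s in (0 : ℝ)..t, g s)) (Icc 0 T) :=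
    integrableOn_smul hφ.continuous_deriv (hGc.integrableOn_Icc)
  have i2 := integrableOn_smul hφ.continuous hg
  ext i
  have p1 := (EuclideanSpace.proj (𝕜 := ℝ) i : E k →L[ℝ] ℝ).integral_comp_comm i1
  have p2 := (EuclideanSpace.proj (𝕜 := ℝ) i : E k →L[ℝ] ℝ).integral_comp_comm i2
  simp only [map_smul, smul_eq_mul] at p1 p2
  refine p1.symm.trans (Eq.trans ?_ (congrArg Neg.neg p2))
  show ∫ t in Icc 0 T, deriv φ t * (∫ s in (0 : ℝ)..t, g s) i = -∫ t in Icc 0 T, φ t * g t i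
  set γ : ℝ → ℝ := fun t => g t i
  have hγ : IntervalIntegrable γ volume 0 T :=
    (intervalIntegrable_iff_integrableOn_Icc_of_le hT.le).2
      ((EuclideanSpace.proj (𝕜 := ℝ) i : E k →L[ℝ] ℝ).integrable_comp hg)
  have hprim : ∀ t ∈ Icc 0 T, (∫ s in (0 : ℝ)..t, g s) i = ∫ s in (0 : ℝ)..t, γ s := by
    intro t ht
    have hgt : IntervalIntegrable g volume 0 t :=
      hgI.mono_set (by rw [uIcc_of_le ht.1, uIcc_of_le hT.le]; exact Icc_subset_Icc_right ht.2)
    exact ((EuclideanSpace.proj (𝕜 := ℝ) i : E k →L[ℝ] ℝ).intervalIntegral_comp_comm hgt).symm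
  have acG : AbsolutelyContinuousOnInterval (fun t => ∫ s in (0 : ℝ)..t, γ s) 0 T :=
    hγ.absolutelyContinuousOnInterval_intervalIntegral (by simp)
  have acφ : AbsolutelyContinuousOnInterval φ 0 T :=
    ((hφ.1.of_le (by simp)).contDiffOn).absolutelyContinuousOnInterval
  have hparts := acG.integral_mul_deriv_eq_deriv_mul acφ
  rw [hφ.zero_of_notMem (t := T) (by simp), hφ.zero_of_notMem (t := 0) (by simp)] at hparts
  have hd : ∫ t in (0 : ℝ)..T, deriv (fun t => ∫ s in (0 : ℝ)..t, γ s) t * φ t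
      = ∫ t in (0 : ℝ)..T, φ t * γ t := by
    refine intervalIntegral.integral_congr_ae ?_
    filter_upwards [hγ.ae_hasDerivAt_integral] with t ht htm
    rw [(ht (uIoc_subset_uIcc htm) 0 (by simp)).deriv, mul_comm]
  rw [hd] at hparts
  rw [integral_Icc_eq_integral_Ioc, integral_Icc_eq_integral_Ioc,
    ← intervalIntegral.integral_of_le hT.le, ← intervalIntegral.integral_of_le hT.le]
  have hcongr : ∫ t in (0 : ℝ)..T, deriv φ t * (∫ s in (0 : ℝ)..t, g s) i
      = ∫ t in (0 : ℝ)..T, (∫ s in (0 : ℝ)..t, γ s) * deriv φ t := by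
    refine intervalIntegral.integral_congr fun t ht => ?_
    rw [uIcc_of_le hT.le] at ht
    simp only [hprim t ht, mul_comm]
  rw [hcongr, hparts]
  simp [γ]

/-- The primitive of a smooth function with mean zero, compactly supported in `(0,T)`, is again
such a function. -/
theorem isTest_primitive {T : ℝ} {h : ℝ → ℝ} (hh : IsTest T h) (h0 : ∫ t in (0 : ℝ)..T, h t = 0) :
    IsTest T (fun t => ∫ s in (0 : ℝ)..t, h s) ∧
      deriv (fun t => ∫ s in (0 : ℝ)..t, h s) = h := by
  have hder : ∀ t, HasDerivAt (fun t => ∫ s in (0 : ℝ)..t, h s) (h t) t := fun t =>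
    intervalIntegral.integral_hasDerivAt_right (hh.continuous.intervalIntegrable _ _)
      (hh.continuous.stronglyMeasurableAtFilter _ _) hh.continuous.continuousAt
  have hd : deriv (fun t => ∫ s in (0 : ℝ)..t, h s) = h := funext fun t => (hder t).deriv
  have hsub : ∃ a b, 0 < a ∧ b < T ∧ tsupport h ⊆ Icc a b := by
    rcases (tsupport h).eq_empty_or_nonempty with he | hne
    · exact ⟨1, T - 1, by norm_num, by linarith, by simp [he]⟩
    · have hK : IsCompact (tsupport h) := hh.2.1
      exact ⟨sInf (tsupport h), sSup (tsupport h), (hh.2.2 (hK.sInf_mem hne)).1,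
        (hh.2.2 (hK.sSup_mem hne)).2,
        fun t ht => ⟨csInf_le hK.bddBelow ht, le_csSup hK.bddAbove ht⟩⟩
  obtain ⟨a, b, ha, hb, hab⟩ := hsub
  have hz : ∀ t, t ∉ Icc a b → h t = 0 := fun t ht =>
    image_eq_zero_of_notMem_tsupport fun h' => ht (hab h')
  have hsupp : tsupport (fun t => ∫ s in (0 : ℝ)..t, h s) ⊆ Icc a b := by
    refine closure_minimal (fun t ht => ?_) isClosed_Icc
    by_contra hcon
    apply ht
    rcases lt_or_ge t a with hta | hta
    · show ∫ s in (0 : ℝ)..t, h s = 0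
      rw [intervalIntegral.integral_congr (g := fun _ => 0), intervalIntegral.integral_zero]
      intro s hs
      refine hz s fun hs' => ?_
      have := (mem_uIcc.1 hs)
      rcases this with h1 | h1 <;> linarith [h1.1, h1.2, hs'.1]
    · have htb : b < t := by
        by_contra hle
        exact hcon ⟨hta, not_lt.1 hle⟩
      show ∫ s in (0 : ℝ)..t, h s = 0
      rw [← intervalIntegral.integral_add_adjacent_intervals
        (hh.continuous.intervalIntegrable 0 T) (hh.continuous.intervalIntegrable T t), h0, zero_add,
        intervalIntegral.integral_congr (g := fun _ => 0), intervalIntegral.integral_zero]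
      intro s hs
      refine hz s fun hs' => ?_
      have := (mem_uIcc.1 hs)
      rcases this with h1 | h1 <;> linarith [h1.1, h1.2, hs'.2]
  refine ⟨⟨?_, ?_, fun t ht => ?_⟩, hd⟩
  · rw [contDiff_infty_iff_deriv, hd]
    exact ⟨fun t => (hder t).differentiableAt, hh.1⟩
  · exact HasCompactSupport.of_support_subset_isCompact isCompact_Icc
      ((subset_tsupport _).trans hsupp)
  · exact ⟨ha.trans_le (hsupp ht).1, (hsupp ht).2.trans_lt hb⟩

/-- A weakly differentiable function is, up to a constant, the primitive of its weak derivative. -/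
theorem HasWeakDeriv.exists_const {T : ℝ} (hT : 0 < T) {k : ℕ} {x g : L2 T k}
    (h : HasWeakDeriv x g) :
    ∃ c : E k, x =ᵐ[vol T] fun t => c + ∫ s in (0 : ℝ)..t, g s := by
  have hGc : ContinuousOn (fun t => ∫ s in (0 : ℝ)..t, g s) (Icc 0 T) := by
    have := intervalIntegral.continuousOn_primitive_interval (μ := volume) (a := 0) (b := T)
      (f := g) (by rw [uIcc_of_le hT.le]; exact integrableOn_L2 g)
    rwa [uIcc_of_le hT.le] at this
  set z : ℝ → E k := fun t => x t - ∫ s in (0 : ℝ)..t, g s with hz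
  have hzi : IntegrableOn z (Icc 0 T) := (integrableOn_L2 x).sub hGc.integrableOn_Icc
  have hz0 : ∀ φ, IsTest T φ → ∫ t in Icc 0 T, deriv φ t • z t = 0 := by
    intro φ hφ
    simp only [hz, smul_sub]
    rw [integral_sub (integrableOn_smul hφ.continuous_deriv (integrableOn_L2 x))
      (integrableOn_smul hφ.continuous_deriv hGc.integrableOn_Icc),
      integral_deriv_smul_primitive hT (integrableOn_L2 g) hφ, h φ hφ, sub_self]
  let b : ContDiffBump (T / 2) := ⟨T / 8, T / 4, by linarith, by linarith⟩
  set ρ : ℝ → ℝ := b.normed volume with hρ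
  have hρt : IsTest T ρ := by
    refine ⟨b.contDiff_normed, b.hasCompactSupport_normed, ?_⟩
    rw [hρ, b.tsupport_normed_eq, Real.closedBall_eq_Icc]
    intro t ht
    have h1 : b.rOut = T / 4 := rfl
    rw [h1] at ht
    exact ⟨by linarith [ht.1], by linarith [ht.2]⟩
  have toI : ∀ φ, IsTest T φ → ∫ t in (0 : ℝ)..T, φ t = ∫ t, φ t := fun φ hφ => by
    rw [intervalIntegral.integral_of_le hT.le, ← integral_Icc_eq_integral_Ioc,
      setIntegral_eq_integral_of_forall_compl_eq_zero]
    intro t ht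
    exact hφ.zero_of_notMem fun h' => ht (Ioo_subset_Icc_self h')
  have hρ1 : ∫ t in (0 : ℝ)..T, ρ t = 1 := by
    rw [toI ρ hρt]; exact b.integral_normed
  refine ⟨∫ t in Icc 0 T, ρ t • z t, ?_⟩
  set c : E k := ∫ t in Icc 0 T, ρ t • z t with hc
  have hcI : IntegrableOn (fun _ : ℝ => c) (Icc 0 T) := continuousOn_const.integrableOn_Icc
  have hae : (fun t => z t - c) =ᵐ[vol T] 0 := by
    refine ae_zero_of_test (hzi.sub hcI) fun ψ hψ => ?_
    set m : ℝ := ∫ t in (0 : ℝ)..T, ψ t with hm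
    have hη : IsTest T (fun t => ψ t - m * ρ t) := by
      refine ⟨hψ.1.sub (contDiff_const.mul hρt.1), hψ.2.1.sub (hρt.2.1.mul_left), ?_⟩
      intro t ht
      by_contra hcon
      have h1 : t ∉ tsupport ψ := fun h' => hcon (hψ.2.2 h')
      have h2 : t ∉ tsupport ρ := fun h' => hcon (hρt.2.2 h')
      rw [notMem_tsupport_iff_eventuallyEq] at h1 h2
      refine (notMem_tsupport_iff_eventuallyEq.2 ?_) ht
      filter_upwards [h1, h2] with s hs1 hs2
      simp [hs1, hs2]
    have hη0 : ∫ t in (0 : ℝ)..T, (ψ t - m * ρ t) = 0 := by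
      rw [intervalIntegral.integral_sub (hψ.continuous.intervalIntegrable _ _)
        ((hρt.continuous.const_mul m).intervalIntegrable _ _),
        intervalIntegral.integral_const_mul, hρ1, mul_one, sub_self]
    obtain ⟨hΦ, hΦd⟩ := isTest_primitive hη hη0
    have key := hz0 _ hΦ
    rw [hΦd] at key
    simp only [sub_smul, mul_smul] at key
    have hρm : IntegrableOn (fun t => m • ρ t • z t) (Icc 0 T) :=
      (integrableOn_smul hρt.continuous hzi).smul m
    rw [integral_sub (integrableOn_smul hψ.continuous hzi) hρm, integral_smul, ← hc] at key
    simp only [smul_sub]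
    rw [integral_sub (integrableOn_smul hψ.continuous hzi)
      (integrableOn_smul hψ.continuous hcI), integral_smul_const,
      integral_Icc_eq_integral_Ioc (f := ψ), ← intervalIntegral.integral_of_le hT.le]
    exact key
  filter_upwards [hae] with t ht
  have : x t - (∫ s in (0 : ℝ)..t, g s) - c = 0 := ht
  rw [sub_sub, sub_eq_zero] at this
  rw [this, add_comm]

theorem exists_contRep {T : ℝ} (hT : 0 < T) {k : ℕ} (x : H1 T k) :
    ∃ ξ, IsContRep (x : L2 T k) ξ := by
  obtain ⟨c, hc⟩ := (hasWeakDeriv_weakDeriv x).exists_const hT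
  refine ⟨_, ?_, hc⟩
  have := intervalIntegral.continuousOn_primitive_interval (μ := volume) (a := 0) (b := T)
    (f := weakDeriv T k x) (by rw [uIcc_of_le hT.le]; exact integrableOn_L2 _)
  rw [uIcc_of_le hT.le] at this
  exact continuousOn_const.add this

theorem isContRep_choose {T : ℝ} (hT : 0 < T) {k : ℕ} (x : H1 T k) :
    IsContRep (x : L2 T k) (exists_contRep hT x).choose := (exists_contRep hT x).choose_spec

/-- The initial value `x(0)` of `x ∈ H¹`, i.e. the value at `0` of its continuous
representative. -/
def initVal {T : ℝ} (hT : 0 < T) (k : ℕ) : H1 T k →ₗ[ℝ] E k where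
  toFun x := (exists_contRep hT x).choose 0
  map_add' x y := by
    have hx := isContRep_choose hT x
    have hy := isContRep_choose hT y
    have : IsContRep ((x + y : H1 T k) : L2 T k)
        (fun t => (exists_contRep hT x).choose t + (exists_contRep hT y).choose t) :=
      ⟨hx.1.add hy.1, (Lp.coeFn_add (x : L2 T k) (y : L2 T k)).trans (hx.2.add hy.2)⟩
    exact (isContRep_choose hT (x + y)).eqOn hT this ⟨le_rfl, hT.le⟩
  map_smul' c x := by
    have hx := isContRep_choose hT x
    have : IsContRep ((c • x : H1 T k) : L2 T k)
        (fun t => c • (exists_contRep hT x).choose t) :=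
      ⟨hx.1.const_smul c, (Lp.coeFn_smul c (x : L2 T k)).trans (hx.2.const_smul c)⟩
    exact (isContRep_choose hT (c • x)).eqOn hT this ⟨le_rfl, hT.le⟩

theorem initVal_eq {T : ℝ} (hT : 0 < T) {k : ℕ} (x : H1 T k) {ξ : ℝ → E k}
    (h : IsContRep (x : L2 T k) ξ) : initVal hT k x = ξ 0 :=
  (isContRep_choose hT x).eqOn hT h ⟨le_rfl, hT.le⟩

/-! ## The optimal control problem -/

/-- The space `L²([0,T], ℝⁿ) × L²([0,T], ℝᵐ)` of states and controls, a Hilbert space with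
`⟪(x,u), (y,v)⟫ = ⟪x,y⟫ + ⟪u,v⟫`. -/
abbrev Primal (T : ℝ) (n m : ℕ) : Type := WithLp 2 (L2 T n × L2 T m)

/-- The Hilbert space `L²([0,T], ℝⁿ) × ℝⁿ` of multipliers and of constraint data. -/
abbrev Dual (T : ℝ) (n : ℕ) : Type := WithLp 2 (L2 T n × E n)

/-- A constant matrix acting pointwise, as a bounded operator `L²([0,T], ℝᵐ) → L²([0,T], ℝⁿ)`. -/
def matL2 (T : ℝ) {n m : ℕ} (M : Matrix (Fin n) (Fin m) ℝ) : L2 T m →L[ℝ] L2 T n :=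
  ContinuousLinearMap.compLpL 2 (vol T) (Matrix.toEuclideanLin M).toContinuousLinearMap

/-- The unbounded constraint operator `C (x, u) = (d/dτ x - A x - B u, x(0))` with domain
`H¹ × L²`. -/
def constraintOp {T : ℝ} (hT : 0 < T) {n m : ℕ} (A : Matrix (Fin n) (Fin n) ℝ)
    (B : Matrix (Fin n) (Fin m) ℝ) : Primal T n m →ₗ.[ℝ] Dual T n where
  domain := (H1 T n).comap (WithLp.fstₗ 2 ℝ (L2 T n) (L2 T m))
  toFun :=
    { toFun := fun z => WithLp.toLp 2
        (weakDeriv T n ⟨z.1.fst, z.2⟩ - matL2 T A z.1.fst - matL2 T B z.1.snd,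
          initVal hT n ⟨z.1.fst, z.2⟩)
      map_add' := fun z w => by
        have h1 := (weakDeriv T n).map_add ⟨z.1.fst, z.2⟩ ⟨w.1.fst, w.2⟩
        have h2 := (initVal hT n).map_add ⟨z.1.fst, z.2⟩ ⟨w.1.fst, w.2⟩
        have h3 := (matL2 T A).map_add z.1.fst w.1.fst
        have h4 := (matL2 T B).map_add z.1.snd w.1.snd
        rw [← WithLp.toLp_add, Prod.mk_add_mk, ← h2]
        refine congrArg (WithLp.toLp 2) (Prod.ext ?_ rfl)
        refine (congrArg₂ (· - ·) (congrArg₂ (· - ·) h1 h3) h4).trans ?_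
        simp only [add_sub_add_comm]
      map_smul' := fun c z => by
        have h1 := (weakDeriv T n).map_smul c ⟨z.1.fst, z.2⟩
        have h2 := (initVal hT n).map_smul c ⟨z.1.fst, z.2⟩
        have h3 := (matL2 T A).map_smul c z.1.fst
        have h4 := (matL2 T B).map_smul c z.1.snd
        rw [RingHom.id_apply, ← WithLp.toLp_smul, Prod.smul_mk, ← h2]
        refine congrArg (WithLp.toLp 2) (Prod.ext ?_ rfl)
        refine (congrArg₂ (· - ·) (congrArg₂ (· - ·) h1 h3) h4).trans ?_
        simp only [smul_sub] }

/-- `D(C)` is dense, so that the Hilbert space adjoint `C*` is well defined. -/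
theorem dense_domain_constraintOp {T : ℝ} (hT : 0 < T) {n m : ℕ} (A : Matrix (Fin n) (Fin n) ℝ)
    (B : Matrix (Fin n) (Fin m) ℝ) : Dense ((constraintOp hT A B).domain : Set (Primal T n m)) := by
  rw [Submodule.dense_iff_topologicalClosure_eq_top, Submodule.topologicalClosure_eq_top_iff,
    Submodule.eq_bot_iff]
  intro w hw
  rw [Submodule.mem_orthogonal] at hw
  have h2 : w.snd = 0 := by
    have := hw (WithLp.toLp 2 (0, w.snd)) (H1 T n).zero_mem
    rw [WithLp.prod_inner_apply] at this
    simpa using this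
  have h1 : w.fst = 0 := by
    refine Lp.ext ((ae_zero_of_test (integrableOn_L2 w.fst) fun φ hφ => ?_).trans
      (Lp.coeFn_zero _ _ _).symm)
    refine ext_inner_right ℝ fun v => ?_
    rw [inner_zero_left]
    have mem : ∀ ψ : ℝ → ℝ, Continuous ψ → MemLp (fun t => ψ t • v) 2 (vol T) := by
      intro ψ hψ
      have hc : Continuous fun t => ψ t • v := hψ.smul continuous_const
      obtain ⟨K, hK⟩ := isCompact_Icc.exists_bound_of_continuousOn
        (hc.continuousOn (s := Icc 0 T))
      exact MemLp.of_bound hc.aestronglyMeasurable K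
        ((ae_restrict_iff' measurableSet_Icc).2 (Filter.Eventually.of_forall hK))
    have hH : (mem φ hφ.continuous).toLp ∈ H1 T n := by
      refine ⟨(mem _ hφ.continuous_deriv).toLp, fun ψ hψ => ?_⟩
      have e1 := (mem φ hφ.continuous).coeFn_toLp
      have e2 := (mem _ hφ.continuous_deriv).coeFn_toLp
      have key := integral_deriv_smul_primitive hT (k := n) (g := fun t => deriv φ t • v)
        (hφ.continuous_deriv.smul continuous_const).continuousOn.integrableOn_Icc hψ
      have prim : ∀ t, ∫ s in (0 : ℝ)..t, deriv φ s • v = φ t • v := fun t => by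
        rw [intervalIntegral.integral_smul_const, intervalIntegral.integral_deriv_eq_sub
          (fun s _ => (hφ.1.differentiable (by simp)) s)
          (hφ.continuous_deriv.intervalIntegrable _ _),
          hφ.zero_of_notMem (t := 0) (by simp), sub_zero]
      simp only [prim] at key
      rw [integral_congr_ae (g := fun t => deriv ψ t • φ t • v) (by
          filter_upwards [e1] with t ht
          rw [ht]), key, neg_inj]
      refine integral_congr_ae ?_
      filter_upwards [e2] with t ht
      rw [ht]
    have := hw (WithLp.toLp 2 ((mem φ hφ.continuous).toLp, 0)) hH
    rw [WithLp.prod_inner_apply, L2.inner_def] at this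
    rw [real_inner_comm, ← integral_inner (integrableOn_smul hφ.continuous (integrableOn_L2 w.fst))]
    simp only [inner_zero_left, add_zero] at this
    refine Eq.trans (integral_congr_ae ?_) this
    filter_upwards [(mem φ hφ.continuous).coeFn_toLp] with t ht
    rw [ht, real_inner_smul_left, real_inner_smul_right]
    rfl
  exact (WithLp.ofLp_injective 2) (Prod.ext h1 h2)

/-- The cost functional `J(x, u) = ∫₀ᵀ ℓ(x(τ)) + (α/2) ‖u(τ)‖² dτ`. -/
def cost {T : ℝ} {n m : ℕ} (ℓ : E n → ℝ) (α : ℝ) (x : L2 T n) (u : L2 T m) : ℝ :=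
  ∫ t in Icc 0 T, (ℓ (x t) + α / 2 * ‖u t‖ ^ 2)

/-- `z = (x, u) ∈ D(C)` is a global minimizer of `J` subject to `C (x, u) = (f, x⁰)`. -/
def IsOptimal {T : ℝ} (hT : 0 < T) {n m : ℕ} (A : Matrix (Fin n) (Fin n) ℝ)
    (B : Matrix (Fin n) (Fin m) ℝ) (ℓ : E n → ℝ) (α : ℝ) (f : L2 T n) (x₀ : E n)
    (z : (constraintOp hT A B).domain) : Prop :=
  constraintOp hT A B z = WithLp.toLp 2 (f, x₀) ∧
    ∀ w : (constraintOp hT A B).domain, constraintOp hT A B w = WithLp.toLp 2 (f, x₀) →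
      cost ℓ α z.1.fst z.1.snd ≤ cost ℓ α w.1.fst w.1.snd

/-- The `L²` gradient `(∇ₓ J(x,u), ∇ᵤ J(x,u))` of the cost functional. -/
def costGrad {T : ℝ} {n m : ℕ} (ℓ : E n → ℝ) (α : ℝ) (z : Primal T n m) : Primal T n m :=
  WithLp.toLp 2 (gradient (fun x : L2 T n => cost ℓ α x z.snd) z.fst,
    gradient (fun u : L2 T m => cost ℓ α z.fst u) z.snd)

open scoped LinearPMap in
/-- The domain `D(C) × D(C*)` of the KKT operator, where `C*` is the Hilbert space adjoint. -/
def kktDomain {T : ℝ} (hT : 0 < T) {n m : ℕ} (A : Matrix (Fin n) (Fin n) ℝ)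
    (B : Matrix (Fin n) (Fin m) ℝ) : Set (WithLp 2 (Primal T n m × Dual T n)) :=
  {p | p.fst ∈ (constraintOp hT A B).domain ∧ p.snd ∈ ((constraintOp hT A B)†).domain}

open scoped LinearPMap in
/-- The KKT operator `M_opt (x, u, (λ, λ₀)) = (∇J(x,u) - C* (λ, λ₀), C (x, u))`. -/
def kktOp {T : ℝ} (hT : 0 < T) {n m : ℕ} (A : Matrix (Fin n) (Fin n) ℝ)
    (B : Matrix (Fin n) (Fin m) ℝ) (ℓ : E n → ℝ) (α : ℝ) (p : kktDomain hT A B) :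
    WithLp 2 (Primal T n m × Dual T n) :=
  WithLp.toLp 2
    (costGrad ℓ α p.1.fst - (constraintOp hT A B)† ⟨p.1.snd, p.2.2⟩,
      constraintOp hT A B ⟨p.1.fst, p.2.1⟩)

/-- A (not necessarily linear) operator `M : H ⊇ D → H` is m-accretive: it is accretive, and
`λ I + M` is onto for every `λ > 0`. -/
def IsMAccretive {H : Type*} [NormedAddCommGroup H] [InnerProductSpace ℝ H] {D : Set H}
    (M : D → H) : Prop :=
  (∀ p q : D, 0 ≤ ⟪M p - M q, (p : H) - (q : H)⟫_ℝ) ∧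
    ∀ lam : ℝ, 0 < lam → Function.Surjective fun p : D => lam • (p : H) + M p

end OptCtrl

end

open OptCtrl
open scoped LinearPMap

/-!
The state equation is solved once and for all by a bounded operator `S`: for all data `(g, y)` there
is exactly one `x = S (g, y)` in `H¹` with `x' = A x + g` and `x(0) = y`. With `K u = (B u, 0)` the
constraint operator becomes `C (S d, u) = d - K u` on the domain `ran S × L²`
(`isSolutionOp_constraintOp`), and everything else is Hilbert space theory that uses only this
description (`IsSolutionOp`).

* The operator `S` exists because `x' = A x + g`, `x(0) = y` is the equation `x - V x = y + ∫₀ᵗ g`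
  with the Volterra operator `V x = ∫₀ᵗ A x`. The operator `1 - V` is injective on `L²` by
  Grönwall's inequality and surjective by the variation of constants formula, which is needed only
  for continuous data because `V` maps `L²` into the continuous functions. It is thus an
  isomorphism (`volterraEquiv`).
* Since `D(C)` is dense, `C* (S* p) = (p, -K* S* p)`; since `C` is onto, `C*` is injective.
* Let `Φ(x) = ∫ ℓ(x)`, a convex differentiable function on `L²`. Eliminating `x` and the multiplier
  from the system `μ z + M_opt z = r`, where `μ ≥ 0`, leaves the equation for a critical point of a
  strongly convex continuous function on a Hilbert space. This function attains its minimum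
  (`exists_critical_point`), hence `μ + M_opt` is onto (`IsSolutionOp.exists_kkt`). The case `μ = 0`
  is the solvability of the optimality system.
* The part `(-C* λ, C z)` of `M_opt` is skew-symmetric and `∇J` is monotone, strongly monotone in
  `u`. So `M_opt` is accretive, and two points with the same image have the same control, hence the
  same state and, as `C*` is injective, the same multiplier.
* At a solution of the optimality system the gradient `∇J = C* λ` is orthogonal to all feasible
  directions. Convexity then gives optimality, and the quadratic gap in `u` gives uniqueness
  (`cost_add_le_of_kkt`).
-/

noncomputable section

namespace OptCtrl

/-! ### Convex minimization in Hilbert spaces -/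

section Hilbert

variable {H X : Type*} [NormedAddCommGroup H] [InnerProductSpace ℝ H]
  [NormedAddCommGroup X] [InnerProductSpace ℝ X]

theorem add_inner_gradient_le [CompleteSpace X] {φ : X → ℝ} (hφ : ConvexOn ℝ univ φ)
    {x g : X} (hg : HasGradientAt φ g x) (y : X) : φ x + ⟪g, y - x⟫_ℝ ≤ φ y := by
  have hd : HasDerivAt (fun s : ℝ => φ (AffineMap.lineMap x y s)) ⟪g, y - x⟫_ℝ 0 := by
    have h1 : HasFDerivAt φ (InnerProductSpace.toDual ℝ X g) (AffineMap.lineMap x y (0 : ℝ)) := by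
      simpa using hg.hasFDerivAt
    exact h1.comp_hasDerivAt (0 : ℝ) (AffineMap.hasDerivAt_lineMap (a := x) (b := y))
  have hc : ConvexOn ℝ univ (fun s : ℝ => φ (AffineMap.lineMap x y s)) := by
    exact hφ.comp_affineMap (AffineMap.lineMap (k := ℝ) x y)
  have := hc.le_slope_of_hasDerivAt (mem_univ 0) (mem_univ 1) one_pos hd
  rw [slope_def_field] at this
  simp at this
  linarith

/-- A continuous function that is bounded below and uniformly strongly midpoint convex attains its
minimum: minimizing sequences are Cauchy. -/
theorem exists_forall_le_of_midpoint [CompleteSpace H] {F : H → ℝ} (hF : Continuous F) {c : ℝ}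
    (hc : 0 < c) (hb : BddBelow (range F))
    (hmid : ∀ v w, F ((1 / 2 : ℝ) • (v + w)) ≤ (F v + F w) / 2 - c * ‖v - w‖ ^ 2) :
    ∃ w, ∀ v, F w ≤ F v := by
  have hm : ∀ v, iInf F ≤ F v := fun v => ciInf_le hb v
  have hex : ∀ k : ℕ, ∃ w, F w < iInf F + 1 / ((k : ℝ) + 1) := fun k =>
    exists_lt_of_ciInf_lt (lt_add_of_pos_right _ (by positivity))
  choose w hw using hex
  -- The midpoint inequality bounds `c ‖w j - w k‖ ^ 2` by the excess of `F (w j)`, `F (w k)` over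
  -- the infimum.
  have hlim := tendsto_one_div_add_atTop_nhds_zero_nat (𝕜 := ℝ)
  have hcau : CauchySeq w := by
    refine cauchySeq_of_le_tendsto_0 (fun N : ℕ => √(1 / ((N : ℝ) + 1) / c)) ?_ ?_
    · intro j k N hj hk
      have le : ∀ i : ℕ, N ≤ i → F (w i) ≤ iInf F + 1 / ((N : ℝ) + 1) := fun i hi =>
        (hw i).le.trans (by gcongr)
      rw [dist_eq_norm]
      refine Real.le_sqrt_of_sq_le ?_
      rw [le_div_iff₀ hc]
      linarith [hmid (w j) (w k), hm ((1 / 2 : ℝ) • (w j + w k)), le j hj, le k hk]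
    · have h := (hlim.div_const c).sqrt
      simpa using h
  obtain ⟨w₀, h₀⟩ := cauchySeq_tendsto_of_complete hcau
  refine ⟨w₀, fun v => le_trans ?_ (hm v)⟩
  refine le_of_tendsto_of_tendsto ((hF.tendsto w₀).comp h₀) ?_
    (Filter.Eventually.of_forall fun k => (hw k).le)
  simpa using hlim.const_add (iInf F)

/-- Solvability of the regularized optimality system `β w + Q† ∇φ(e + Q w) = b`, the equation for
the critical points of the strongly convex function
`w ↦ (β / 2) ‖w‖ ^ 2 + φ (e + Q w) - ⟪b, w⟫`. -/
theorem exists_critical_point [CompleteSpace H] [CompleteSpace X] {φ : X → ℝ} {g : X → X}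
    (hg : ∀ x, HasGradientAt φ (g x) x) (hφ : ConvexOn ℝ univ φ) {β : ℝ} (hβ : 0 < β)
    (Q : H →L[ℝ] X) (e : X) (b : H) :
    ∃ w, ∀ h, β * ⟪w, h⟫_ℝ + ⟪g (e + Q w), Q h⟫_ℝ = ⟪b, h⟫_ℝ := by
  set F : H → ℝ := fun w => β / 2 * ‖w‖ ^ 2 + φ (e + Q w) - ⟪b, w⟫_ℝ with hF
  have hd : ∀ w, HasFDerivAt F ((β / 2) • ((2 : ℝ) • innerSL ℝ w)
      + (InnerProductSpace.toDual ℝ X (g (e + Q w))).comp Q - innerSL ℝ b) w := fun w =>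
    ((((hasStrictFDerivAt_norm_sq w).hasFDerivAt.congr_fderiv (by ext; simp)).const_mul
      (β / 2)).add ((hg (e + Q w)).hasFDerivAt.comp w (Q.hasFDerivAt.const_add e))).sub
      (innerSL ℝ b).hasFDerivAt
  have hcont : Continuous F := continuous_iff_continuousAt.2 fun w => (hd w).continuousAt
  have hbdd : BddBelow (range F) := by
    -- The gradient inequality at `e` bounds `F` below by a quadratic; complete the square.
    set q : H := Q.adjoint (g e) - b with hq
    refine ⟨φ e - ‖q‖ ^ 2 / (2 * β), ?_⟩
    rintro _ ⟨w, rfl⟩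
    have h1 := add_inner_gradient_le hφ (hg e) (e + Q w)
    rw [add_sub_cancel_left, ← ContinuousLinearMap.adjoint_inner_left] at h1
    have h2 : 0 ≤ ‖β • w + q‖ ^ 2 := by positivity
    rw [norm_add_sq_real, norm_smul, Real.norm_eq_abs, mul_pow, sq_abs, real_inner_smul_left,
      real_inner_comm, hq, inner_sub_left, ← hq] at h2
    have h3 : 0 ≤ (β ^ 2 * ‖w‖ ^ 2 + 2 * (β * (⟪Q.adjoint (g e), w⟫_ℝ - ⟪b, w⟫_ℝ)) + ‖q‖ ^ 2)
        / (2 * β) := by positivity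
    have h4 : (β ^ 2 * ‖w‖ ^ 2 + 2 * (β * (⟪Q.adjoint (g e), w⟫_ℝ - ⟪b, w⟫_ℝ)) + ‖q‖ ^ 2)
        / (2 * β) = β / 2 * ‖w‖ ^ 2 + (⟪Q.adjoint (g e), w⟫_ℝ - ⟪b, w⟫_ℝ)
          + ‖q‖ ^ 2 / (2 * β) := by
      field_simp
    simp only [hF]
    linarith
  obtain ⟨w, hw⟩ := exists_forall_le_of_midpoint hcont (c := β / 8) (by positivity) hbdd (by
    intro v w
    have h1 := hφ.2 (mem_univ (e + Q v)) (mem_univ (e + Q w)) one_half_pos.le one_half_pos.le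
      (add_halves 1)
    have h2 : (1 / 2 : ℝ) • (e + Q v) + (1 / 2 : ℝ) • (e + Q w)
        = e + Q ((1 / 2 : ℝ) • (v + w)) := by
      rw [map_smul, map_add]; module
    have h3 := parallelogram_law_with_norm ℝ v w
    rw [h2] at h1
    simp only [hF, norm_smul, inner_smul_right, inner_add_right, mul_pow, smul_eq_mul] at h1 ⊢
    norm_num at h1 ⊢
    linear_combination h1 + β / 8 * h3)
  refine ⟨w, fun h => ?_⟩
  have h0 := (IsLocalMin.hasFDerivAt_eq_zero (Filter.Eventually.of_forall hw) (hd w))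
  have := congrArg (fun L : H →L[ℝ] ℝ => L h) h0
  simp at this
  linarith

end Hilbert

/-! ### Optimality systems of constraints given by a solution operator -/

section SolutionOperator

variable {X U D : Type*} [NormedAddCommGroup X] [InnerProductSpace ℝ X]
  [NormedAddCommGroup U] [InnerProductSpace ℝ U]
  [NormedAddCommGroup D] [InnerProductSpace ℝ D]

/-- `S` is the solution operator of the unbounded constraint `C (x, u) = d` with control operator
`K`: the domain of `C` is `ran S × U`, and there `C (x, u) = d` holds if and only if
`x = S (d + K u)`. -/
structure IsSolutionOp (C : WithLp 2 (X × U) →ₗ.[ℝ] D) (S : D →L[ℝ] X) (K : U →L[ℝ] D) :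
    Prop where
  solve : ∀ z : C.domain, S (C z + K z.1.snd) = z.1.fst
  mem : ∀ d u, (WithLp.toLp 2 (S d, u) : WithLp 2 (X × U)) ∈ C.domain
  apply : ∀ d u, C ⟨WithLp.toLp 2 (S d, u), mem d u⟩ = d - K u

namespace IsSolutionOp

variable {C : WithLp 2 (X × U) →ₗ.[ℝ] D} {S : D →L[ℝ] X} {K : U →L[ℝ] D}

theorem surjective (h : IsSolutionOp C S K) (d : D) : ∃ z, C z = d :=
  ⟨⟨_, h.mem d 0⟩, by rw [h.apply, map_zero, sub_zero]⟩

/-- The state is determined by the control and the right-hand side. -/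
theorem eq_of_snd_eq (h : IsSolutionOp C S K) {z w : C.domain} (hC : C z = C w)
    (hu : z.1.snd = w.1.snd) : z = w := by
  refine Subtype.ext (WithLp.ofLp_injective 2 (Prod.ext ?_ hu))
  exact ((h.solve z).symm.trans (by rw [hC, hu])).trans (h.solve w)

variable [CompleteSpace X] [CompleteSpace U]

/-- `C*` is injective since `C` is surjective. -/
theorem adjoint_injective (h : IsSolutionOp C S K)
    (hd : Dense (C.domain : Set (WithLp 2 (X × U)))) : Function.Injective C† := by
  intro l l' hl
  refine Subtype.ext (ext_inner_right ℝ fun d => ?_)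
  obtain ⟨z, rfl⟩ := h.surjective d
  have h1 := LinearPMap.adjoint_isFormalAdjoint hd l z
  have h2 := LinearPMap.adjoint_isFormalAdjoint hd l' z
  rw [← h1, ← h2, hl]

variable [CompleteSpace D]

theorem inner_adjoint (h : IsSolutionOp C S K) (p : X) (z : C.domain) :
    ⟪(WithLp.toLp 2 (p, -K.adjoint (S.adjoint p)) : WithLp 2 (X × U)), z⟫_ℝ
      = ⟪S.adjoint p, C z⟫_ℝ := by
  rw [WithLp.prod_inner_apply]
  change ⟪p, z.1.fst⟫_ℝ + ⟪-K.adjoint (S.adjoint p), z.1.snd⟫_ℝ = _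
  rw [inner_neg_left, ContinuousLinearMap.adjoint_inner_left,
    ContinuousLinearMap.adjoint_inner_left, ContinuousLinearMap.adjoint_inner_left,
    ← inner_neg_right, ← inner_add_right, ← h.solve z, map_add]
  simp

theorem mem_adjoint_domain (h : IsSolutionOp C S K) (p : X) : S.adjoint p ∈ C†.domain :=
  LinearPMap.mem_adjoint_domain_of_exists _ ⟨_, h.inner_adjoint p⟩

/-- The adjoint equation: `C* λ = (p, -K* λ)` is solved by `λ = S* p`. -/
theorem adjoint_apply (h : IsSolutionOp C S K) (hd : Dense (C.domain : Set (WithLp 2 (X × U))))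
    (p : X) : C† ⟨S.adjoint p, h.mem_adjoint_domain p⟩
      = WithLp.toLp 2 (p, -K.adjoint (S.adjoint p)) :=
  LinearPMap.adjoint_apply_eq hd _ (h.inner_adjoint p)

/-- Solvability of the optimality system shifted by `μ ≥ 0`. Eliminating the multiplier leaves the
critical point equation of a strongly convex function of the control `u` and of a slack variable
`v` for the constraint, which enters as `C (x, u) = c + √(μ (α + μ)) v`. -/
theorem exists_kkt (h : IsSolutionOp C S K) (hd : Dense (C.domain : Set (WithLp 2 (X × U))))
    {φ : X → ℝ} {g : X → X} (hg : ∀ x, HasGradientAt φ (g x) x) (hφ : ConvexOn ℝ univ φ)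
    {α μ : ℝ} (hα : 0 < α) (hμ : 0 ≤ μ) (a : X) (b : U) (c : D) :
    ∃ (z : C.domain) (l : C†.domain),
      μ • z.1.fst + (g z.1.fst - (C† l).fst) = a ∧
      μ • z.1.snd + (α • z.1.snd - (C† l).snd) = b ∧
      μ • (l : D) + C z = c := by
  have hβ : 0 < α + μ := by positivity
  set β := α + μ with hβ_def
  set σ := √(μ * β)
  have hσ : σ * σ = μ * β := Real.mul_self_sqrt (by positivity)
  -- The shift by `μ` and the datum `a` are absorbed into the state cost.
  set φ' : X → ℝ := fun x => φ x + (μ / 2 * ‖x‖ ^ 2 - ⟪a, x⟫_ℝ)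
  have hg' : ∀ x, HasGradientAt φ' (g x + μ • x - a) x := by
    intro x
    rw [hasGradientAt_iff_hasFDerivAt]
    have h1 := ((hasStrictFDerivAt_norm_sq x).hasFDerivAt.const_mul (μ / 2)).sub
      (innerSL ℝ a).hasFDerivAt
    refine ((hg x).hasFDerivAt.add h1).congr_fderiv ?_
    ext y
    simp
    ring
  have hφ' : ConvexOn ℝ univ φ' := by
    have h1 : ConvexOn ℝ univ fun x : X => ‖x‖ ^ 2 :=
      (convexOn_norm convex_univ).pow (fun _ _ => norm_nonneg _) 2
    exact hφ.add ((h1.smul (by positivity : 0 ≤ μ / 2)).sub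
      ((innerSL ℝ a).toLinearMap.concaveOn convex_univ))
  set Q : WithLp 2 (U × D) →L[ℝ] X :=
    S ∘L (K ∘L WithLp.fstL 2 ℝ U D + σ • WithLp.sndL 2 ℝ U D)
  obtain ⟨w, hw⟩ := exists_critical_point hg' hφ' hβ Q (S c) (WithLp.toLp 2 (b, 0))
  set u := w.fst with hu
  set v := w.snd with hv
  have hx : S c + Q w = S (c + (K u + σ • v)) := by
    rw [map_add]; rfl
  set x := S (c + (K u + σ • v)) with hx_def
  set p := g x + μ • x - a with hp
  set l := S.adjoint p with hl
  rw [hx] at hw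
  -- The components of the critical point equation along `U` and along `D`.
  have e1 : β • u + K.adjoint l = b := by
    refine ext_inner_right ℝ fun y => ?_
    have := hw (WithLp.toLp 2 (y, 0))
    have hQ : Q (WithLp.toLp 2 (y, 0)) = S (K y) := by simp [Q]
    rw [hQ, WithLp.prod_inner_apply, WithLp.prod_inner_apply] at this
    simp only [inner_zero_right, add_zero] at this
    rw [inner_add_left, real_inner_smul_left, ContinuousLinearMap.adjoint_inner_left,
      ContinuousLinearMap.adjoint_inner_left]
    exact this
  have e2 : β • v + σ • l = 0 := by
    refine ext_inner_right ℝ fun y => ?_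
    have := hw (WithLp.toLp 2 (0, y))
    have hQ : Q (WithLp.toLp 2 (0, y)) = σ • S y := by simp [Q]
    rw [hQ, WithLp.prod_inner_apply, WithLp.prod_inner_apply] at this
    simp only [inner_zero_right, inner_zero_left, zero_add, inner_smul_right] at this
    rw [inner_add_left, real_inner_smul_left, real_inner_smul_left,
      ContinuousLinearMap.adjoint_inner_left, inner_zero_left]
    exact this
  -- The scaling `σ ^ 2 = μ β` makes the slack equal to the shift of the multiplier.
  have e3 : σ • v = -(μ • l) := by
    have h1 : β • (σ • v + μ • l) = 0 := by
      rw [smul_add, smul_comm, smul_smul β μ, mul_comm β, ← hσ, mul_smul, ← smul_add, e2,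
        smul_zero]
    exact eq_neg_of_add_eq_zero_left ((smul_eq_zero.1 h1).resolve_left hβ.ne')
  refine ⟨⟨_, h.mem (c + (K u + σ • v)) u⟩, ⟨l, h.mem_adjoint_domain p⟩, ?_, ?_, ?_⟩
  · rw [h.adjoint_apply hd]
    change μ • x + (g x - p) = a
    rw [hp]; abel
  · rw [h.adjoint_apply hd]
    change μ • u + (α • u - -K.adjoint l) = b
    rw [← e1, hβ_def]; module
  · rw [h.apply, e3]
    change μ • l + _ = c
    abel

end IsSolutionOp

end SolutionOperator

/-! ### The Volterra integral operator -/

section Volterra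

variable {T : ℝ} {k : ℕ}

theorem integral_norm_le (g : L2 T k) :
    ∫ t in Icc 0 T, ‖g t‖ ≤ (vol T).real univ ^ (1 / 2 : ℝ) * ‖g‖ := by
  have h1 := eLpNorm_le_eLpNorm_mul_rpow_measure_univ (p := 1) (q := 2) (μ := vol T)
    (by norm_num) (Lp.memLp g).1
  have h2 := ENNReal.toReal_mono (by
    refine ENNReal.mul_ne_top (Lp.memLp g).eLpNorm_ne_top (ENNReal.rpow_ne_top_of_nonneg ?_
      (measure_ne_top _ _))
    norm_num) h1
  rw [ENNReal.toReal_mul, ← ENNReal.toReal_rpow, ← Lp.norm_def] at h2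
  rw [eLpNorm_one_eq_lintegral_enorm, ← integral_norm_eq_lintegral_enorm (Lp.memLp g).1] at h2
  refine h2.trans_eq ?_
  rw [mul_comm]
  norm_num [Measure.real]

theorem continuousOn_primitive (hT : 0 < T) (g : L2 T k) :
    ContinuousOn (fun t => ∫ s in (0 : ℝ)..t, g s) (Icc 0 T) := by
  have := intervalIntegral.continuousOn_primitive_interval (μ := volume) (a := 0) (b := T)
    (f := g) (by rw [uIcc_of_le hT.le]; exact integrableOn_L2 g)
  rwa [uIcc_of_le hT.le] at this

theorem intervalIntegrable_L2 (g : L2 T k) {t : ℝ} (ht : t ∈ Icc 0 T) :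
    IntervalIntegrable g volume 0 t :=
  (intervalIntegrable_iff_integrableOn_Icc_of_le ht.1).2
    ((integrableOn_L2 g).mono_set (Icc_subset_Icc_right ht.2))

theorem norm_primitive_le (g : L2 T k) {t : ℝ} (ht : t ∈ Icc 0 T) :
    ‖∫ s in (0 : ℝ)..t, g s‖ ≤ (vol T).real univ ^ (1 / 2 : ℝ) * ‖g‖ := by
  refine (intervalIntegral.norm_integral_le_integral_norm ht.1).trans
    (le_trans ?_ (integral_norm_le g))
  rw [intervalIntegral.integral_of_le ht.1]
  exact setIntegral_mono_set (integrableOn_L2 g).norm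
    (Filter.Eventually.of_forall fun _ => norm_nonneg _)
    ((Ioc_subset_Icc_self.trans (Icc_subset_Icc_right ht.2)).eventuallyLE)

theorem memLp_of_continuousOn {ξ : ℝ → E k} (hξ : ContinuousOn ξ (Icc 0 T)) :
    MemLp ξ 2 (vol T) := by
  obtain ⟨c, hc⟩ := isCompact_Icc.exists_bound_of_continuousOn hξ
  exact MemLp.of_bound (hξ.aestronglyMeasurable measurableSet_Icc) c
    ((ae_restrict_iff' measurableSet_Icc).2 (Filter.Eventually.of_forall hc))

/-- The primitive `t ↦ y + ∫₀ᵗ g` of constraint data `(g, y)`, as a function on `ℝ`; it is used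
only on `[0, T]`. -/
def primFun (d : Dual T k) (t : ℝ) : E k := d.snd + ∫ s in (0 : ℝ)..t, d.fst s

theorem continuousOn_primFun (hT : 0 < T) (d : Dual T k) : ContinuousOn (primFun d) (Icc 0 T) :=
  continuousOn_const.add (continuousOn_primitive hT d.fst)

/-- The bounded operator `(g, y) ↦ y + ∫₀ᵗ g`, which inverts `x ↦ (x', x(0))`. -/
def primL2 (hT : 0 < T) (k : ℕ) : Dual T k →L[ℝ] L2 T k :=
  LinearMap.mkContinuous
    { toFun := fun d => (memLp_of_continuousOn (continuousOn_primFun hT d)).toLp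
      map_add' := fun d e => by
        rw [← MemLp.toLp_add]
        refine MemLp.toLp_congr _ _ ((ae_restrict_iff' measurableSet_Icc).2
          (Filter.Eventually.of_forall fun t ht => ?_))
        have h1 : ∫ s in (0 : ℝ)..t, (d + e).fst s
            = ∫ s in (0 : ℝ)..t, (d.fst s + e.fst s) := by
          rw [intervalIntegral.integral_of_le ht.1, intervalIntegral.integral_of_le ht.1]
          exact integral_congr_ae (ae_restrict_of_ae_restrict_of_subset
            (Ioc_subset_Icc_self.trans (Icc_subset_Icc_right ht.2))
            (Lp.coeFn_add d.fst e.fst))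
        simp only [primFun, Pi.add_apply]
        rw [h1, intervalIntegral.integral_add (intervalIntegrable_L2 _ ht)
          (intervalIntegrable_L2 _ ht), WithLp.add_snd]
        abel
      map_smul' := fun c d => by
        rw [RingHom.id_apply, ← MemLp.toLp_const_smul]
        refine MemLp.toLp_congr _ _ ((ae_restrict_iff' measurableSet_Icc).2
          (Filter.Eventually.of_forall fun t ht => ?_))
        have h1 : ∫ s in (0 : ℝ)..t, (c • d).fst s = ∫ s in (0 : ℝ)..t, c • d.fst s := by
          rw [intervalIntegral.integral_of_le ht.1, intervalIntegral.integral_of_le ht.1]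
          exact integral_congr_ae (ae_restrict_of_ae_restrict_of_subset
            (Ioc_subset_Icc_self.trans (Icc_subset_Icc_right ht.2))
            (Lp.coeFn_smul c d.fst))
        simp only [primFun, Pi.smul_apply]
        rw [h1, intervalIntegral.integral_smul, WithLp.smul_snd, smul_add] }
    ((vol T).real univ ^ (1 / 2 : ℝ) * (1 + (vol T).real univ ^ (1 / 2 : ℝ))) fun d => by
      have hb : ∀ᵐ t ∂vol T, ‖(memLp_of_continuousOn (continuousOn_primFun hT d)).toLp _ t‖
          ≤ (1 + (vol T).real univ ^ (1 / 2 : ℝ)) * ‖d‖ := by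
        filter_upwards [MemLp.coeFn_toLp (memLp_of_continuousOn (continuousOn_primFun hT d)),
          ae_restrict_mem measurableSet_Icc] with t h1 ht
        rw [h1, add_mul, one_mul]
        refine (norm_add_le _ _).trans (add_le_add ?_ ((norm_primitive_le d.fst ht).trans ?_))
        · exact WithLp.norm_snd_le _ d
        · gcongr
          exact WithLp.norm_fst_le _ d
      refine (Lp.norm_le_of_ae_bound (by positivity) hb).trans_eq ?_
      rw [mul_assoc, ENNReal.toReal_ofNat, ← one_div]
      rfl

theorem coeFn_primL2 (hT : 0 < T) (d : Dual T k) : primL2 hT k d =ᵐ[vol T] primFun d :=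
  MemLp.coeFn_toLp (memLp_of_continuousOn (continuousOn_primFun hT d))

theorem isContRep_primL2 (hT : 0 < T) (d : Dual T k) : IsContRep (primL2 hT k d) (primFun d) :=
  ⟨continuousOn_primFun hT d, coeFn_primL2 hT d⟩

theorem hasWeakDeriv_primL2 (hT : 0 < T) (d : Dual T k) :
    HasWeakDeriv (primL2 hT k d) d.fst := by
  intro φ hφ
  rw [← integral_deriv_smul_primitive hT (integrableOn_L2 d.fst) hφ]
  have h0 : ∫ t in Icc 0 T, deriv φ t • d.snd = 0 := by
    rw [integral_smul_const, integral_Icc_eq_integral_Ioc, ← intervalIntegral.integral_of_le hT.le,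
      intervalIntegral.integral_deriv_eq_sub (fun s _ => (hφ.1.differentiable (by simp)) s)
        (hφ.continuous_deriv.intervalIntegrable _ _),
      hφ.zero_of_notMem (t := 0) (by simp), hφ.zero_of_notMem (t := T) (by simp), sub_zero,
      zero_smul]
  rw [← zero_add (∫ t in Icc 0 T, deriv φ t • ∫ s in (0 : ℝ)..t, d.fst s), ← h0,
    ← integral_add (integrableOn_smul hφ.continuous_deriv continuousOn_const.integrableOn_Icc)
      (integrableOn_smul hφ.continuous_deriv (continuousOn_primitive hT d.fst).integrableOn_Icc)]
  refine integral_congr_ae ?_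
  filter_upwards [coeFn_primL2 hT d] with t ht
  rw [ht, primFun, smul_add]

theorem primL2_mem_H1 (hT : 0 < T) (d : Dual T k) : primL2 hT k d ∈ H1 T k :=
  ⟨_, hasWeakDeriv_primL2 hT d⟩

theorem weakDeriv_primL2 (hT : 0 < T) (d : Dual T k) :
    weakDeriv T k ⟨_, primL2_mem_H1 hT d⟩ = d.fst :=
  (hasWeakDeriv_weakDeriv _).unique (hasWeakDeriv_primL2 hT d)

theorem initVal_primL2 (hT : 0 < T) (d : Dual T k) :
    initVal hT k ⟨_, primL2_mem_H1 hT d⟩ = d.snd := by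
  rw [initVal_eq hT _ (isContRep_primL2 hT d)]
  simp [primFun]

theorem primL2_weakDeriv (hT : 0 < T) (x : H1 T k) :
    primL2 hT k (WithLp.toLp 2 (weakDeriv T k x, initVal hT k x)) = x := by
  obtain ⟨c, hc⟩ := (hasWeakDeriv_weakDeriv x).exists_const hT
  have h0 : initVal hT k x = c := by
    rw [initVal_eq hT x ⟨continuousOn_const.add (continuousOn_primitive hT _), hc⟩]
    simp
  rw [h0]
  exact Lp.ext ((coeFn_primL2 hT _).trans hc.symm)

end Volterra

/-! ### The solution operator of `x' = A x + g`, `x(0) = y` -/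

section SolutionOperator

variable {T : ℝ} {k : ℕ}

/-- The operator of a constant matrix on `ℝᵏ`. -/
abbrev matE (A : Matrix (Fin k) (Fin k) ℝ) : E k →L[ℝ] E k :=
  (Matrix.toEuclideanLin A).toContinuousLinearMap

/-- The embedding `g ↦ (g, 0)` of `L²` into the space of constraint data. -/
def inlDual (T : ℝ) (k : ℕ) : L2 T k →L[ℝ] Dual T k :=
  (WithLp.prodContinuousLinearEquiv 2 ℝ (L2 T k) (E k)).symm.toContinuousLinearMap ∘L
    ContinuousLinearMap.inl ℝ (L2 T k) (E k)

/-- The Volterra operator `x ↦ ∫₀ᵗ A x`. -/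
def volterra (hT : 0 < T) (A : Matrix (Fin k) (Fin k) ℝ) : L2 T k →L[ℝ] L2 T k :=
  primL2 hT k ∘L inlDual T k ∘L matL2 T A

theorem volterra_apply (hT : 0 < T) (A : Matrix (Fin k) (Fin k) ℝ) (x : L2 T k) :
    volterra hT A x = primL2 hT k (WithLp.toLp 2 (matL2 T A x, 0)) := rfl

theorem primFun_matL2 (A : Matrix (Fin k) (Fin k) ℝ) {x : L2 T k} {ξ : ℝ → E k}
    (hx : x =ᵐ[vol T] ξ) {t : ℝ} (ht : t ∈ Icc 0 T) :
    primFun (WithLp.toLp 2 (matL2 T A x, 0)) t = ∫ s in (0 : ℝ)..t, matE A (ξ s) := by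
  change 0 + ∫ s in (0 : ℝ)..t, matL2 T A x s = _
  rw [zero_add, intervalIntegral.integral_of_le ht.1,
    intervalIntegral.integral_of_le ht.1]
  refine integral_congr_ae (ae_restrict_of_ae_restrict_of_subset
    (Ioc_subset_Icc_self.trans (Icc_subset_Icc_right ht.2)) ?_)
  filter_upwards [(matE A).coeFn_compLpL (p := 2) (μ := vol T) x, hx] with s h1 h2
  rw [← h2]
  exact h1

theorem volterra_ae (hT : 0 < T) (A : Matrix (Fin k) (Fin k) ℝ) {x : L2 T k} {ξ : ℝ → E k}
    (hx : x =ᵐ[vol T] ξ) :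
    volterra hT A x =ᵐ[vol T] fun t => ∫ s in (0 : ℝ)..t, matE A (ξ s) := by
  filter_upwards [coeFn_primL2 hT (WithLp.toLp 2 (matL2 T A x, 0)),
    ae_restrict_mem measurableSet_Icc] with t h1 ht
  rw [volterra_apply, h1, primFun_matL2 A hx ht]

/-- Variation of constants for a continuous forcing term. -/
theorem exists_eq_integral {F : Type*} [NormedAddCommGroup F] [NormedSpace ℝ F] [CompleteSpace F]
    (a : F →L[ℝ] F) {χ : ℝ → F} (hχ : Continuous χ) :
    ∃ ζ : ℝ → F, Continuous ζ ∧ ∀ t, ζ t = ∫ s in (0 : ℝ)..t, a (χ s + ζ s) := by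
  have hexp : ∀ t : ℝ, HasDerivAt (fun u : ℝ => NormedSpace.exp (u • a))
      (a * NormedSpace.exp (t • a)) t := fun t => hasDerivAt_exp_smul_const' a t
  have hexpc : Continuous fun u : ℝ => NormedSpace.exp (u • a) :=
    continuous_iff_continuousAt.2 fun t => (hexp t).continuousAt
  have hinv : ∀ (t : ℝ) (v : F),
      NormedSpace.exp (t • a) (NormedSpace.exp ((-t) • a) v) = v := by
    intro t v
    have hc : Commute (t • a) ((-t) • a) := ((Commute.refl a).smul_left t).smul_right (-t)
    let _ : NormedAlgebra ℚ (F →L[ℝ] F) := NormedAlgebra.restrictScalars ℚ ℝ _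
    rw [← mul_apply_eq_comp, ← NormedSpace.exp_add_of_commute hc, ← add_smul,
      add_neg_cancel, zero_smul, NormedSpace.exp_zero, one_apply_eq_self]
  set h : ℝ → F := fun s => NormedSpace.exp ((-s) • a) (a (χ s)) with hh
  have hhc : Continuous h :=
    (hexpc.comp continuous_neg).clm_apply (a.continuous.comp hχ)
  have hη : ∀ t, HasDerivAt (fun t => ∫ s in (0 : ℝ)..t, h s) (h t) t := fun t =>
    intervalIntegral.integral_hasDerivAt_right (hhc.intervalIntegrable _ _)
      (hhc.stronglyMeasurableAtFilter _ _) hhc.continuousAt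
  set ζ : ℝ → F := fun t => NormedSpace.exp (t • a) (∫ s in (0 : ℝ)..t, h s) with hζ
  have hd : ∀ t, HasDerivAt ζ (a (χ t + ζ t)) t := by
    intro t
    refine ((hexp t).clm_apply (hη t)).congr_deriv ?_
    rw [hh, hζ, mul_apply_eq_comp]
    simp only [hinv, map_add]
    rw [add_comm]
  have hζc : Continuous ζ := continuous_iff_continuousAt.2 fun t => (hd t).continuousAt
  refine ⟨ζ, hζc, fun t => ?_⟩
  rw [intervalIntegral.integral_eq_sub_of_hasDerivAt (fun s _ => hd s)
    ((a.continuous.comp (hχ.add hζc)).intervalIntegrable _ _)]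
  simp [hζ]

theorem exists_continuous_rep (hT : 0 < T) {x : L2 T k} {ξ : ℝ → E k} (h : IsContRep x ξ) :
    ∃ χ : ℝ → E k, Continuous χ ∧ EqOn χ ξ (Icc 0 T) ∧ x =ᵐ[vol T] χ := by
  have he : EqOn (IccExtend hT.le ((Icc 0 T).domRestrict ξ)) ξ (Icc 0 T) := fun t ht =>
    IccExtend_of_mem hT.le _ ht
  refine ⟨_, (continuousOn_iff_continuous_domRestrict.1 h.1).Icc_extend', he, ?_⟩
  filter_upwards [h.2, ae_restrict_mem measurableSet_Icc] with t h1 ht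
  rw [h1, he ht]

/-- By the integral equation `x = ∫₀ᵗ A x` and Grönwall's inequality, `1` is not an eigenvalue of
the Volterra operator. -/
theorem eq_zero_of_volterra_eq (hT : 0 < T) (A : Matrix (Fin k) (Fin k) ℝ) {x : L2 T k}
    (hx : volterra hT A x = x) : x = 0 := by
  have hrep : IsContRep x (primFun (WithLp.toLp 2 (matL2 T A x, 0))) := by
    have := isContRep_primL2 hT (WithLp.toLp 2 (matL2 T A x, 0))
    rwa [← volterra_apply, hx] at this
  obtain ⟨χ, hχ, heq, hae⟩ := exists_continuous_rep hT hrep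
  have hac : Continuous fun s => matE A (χ s) := (matE A).continuous.comp hχ
  set ξ : ℝ → E k := fun t => ∫ s in (0 : ℝ)..t, matE A (χ s) with hξ
  have hd : ∀ t, HasDerivAt ξ (matE A (χ t)) t := fun t =>
    intervalIntegral.integral_hasDerivAt_right (hac.intervalIntegrable _ _)
      (hac.stronglyMeasurableAtFilter _ _) hac.continuousAt
  have hχξ : ∀ t ∈ Icc 0 T, χ t = ξ t := fun t ht => by
    rw [heq ht, primFun_matL2 A hae ht]
  have hz := eq_zero_of_abs_deriv_le_mul_abs_self_of_eq_zero_right (K := ‖matE A‖) (a := 0)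
    (b := T) (fun t _ => (hd t).continuousAt.continuousWithinAt)
    (fun t _ => (hd t).hasDerivWithinAt) (by simp [hξ]) (fun t ht => by
      rw [← hχξ t (Ico_subset_Icc_self ht)]
      exact (matE A).le_opNorm _)
  refine Lp.ext ?_
  filter_upwards [hae, ae_restrict_mem measurableSet_Icc, Lp.coeFn_zero (E k) 2 (vol T)]
    with t h1 ht h0
  rw [h1, hχξ t ht, hz t ht, h0, Pi.zero_apply]

/-- With `w = volterra v`, which is continuous, and the classical solution `ζ` of
`ζ = ∫₀ᵗ A (w + ζ)`, the function `x = v + w + ζ` solves `x - volterra x = v`. -/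
theorem exists_sub_volterra_eq (hT : 0 < T) (A : Matrix (Fin k) (Fin k) ℝ) (v : L2 T k) :
    ∃ x, x - volterra hT A x = v := by
  obtain ⟨χ, hχ, -, hae⟩ := exists_continuous_rep hT
    (isContRep_primL2 hT (WithLp.toLp 2 (matL2 T A v, 0)))
  rw [← volterra_apply] at hae
  obtain ⟨ζ, hζ, hζe⟩ := exists_eq_integral (matE A) hχ
  have hm : MemLp ζ 2 (vol T) := memLp_of_continuousOn hζ.continuousOn
  have h1 : (volterra hT A v + hm.toLp : L2 T k) =ᵐ[vol T] fun t => χ t + ζ t := by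
    filter_upwards [Lp.coeFn_add (volterra hT A v) hm.toLp, hae, hm.coeFn_toLp] with t e1 e2 e3
    rw [e1, Pi.add_apply, e2, e3]
  have h2 : volterra hT A (volterra hT A v + hm.toLp) = hm.toLp := by
    refine Lp.ext ((volterra_ae hT A h1).trans ?_)
    filter_upwards [hm.coeFn_toLp] with t e1
    rw [e1, hζe t]
  refine ⟨v + (volterra hT A v + hm.toLp), ?_⟩
  rw [map_add, h2]
  abel

/-- `x ↦ x - ∫₀ᵗ A x` as an isomorphism of `L²`. -/
def volterraEquiv (hT : 0 < T) (A : Matrix (Fin k) (Fin k) ℝ) : L2 T k ≃L[ℝ] L2 T k :=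
  ContinuousLinearEquiv.ofBijective (ContinuousLinearMap.id ℝ (L2 T k) - volterra hT A)
    (LinearMap.ker_eq_bot'.2 fun _ hx => eq_zero_of_volterra_eq hT A (sub_eq_zero.1 hx).symm)
    (LinearMap.range_eq_top.2 (exists_sub_volterra_eq hT A))

/-- The operator taking `(g, y)` to the solution of `x' = A x + g`, `x(0) = y`. -/
def solOp (hT : 0 < T) (A : Matrix (Fin k) (Fin k) ℝ) : Dual T k →L[ℝ] L2 T k :=
  (volterraEquiv hT A).symm.toContinuousLinearMap ∘L primL2 hT k

theorem solOp_eq_iff (hT : 0 < T) (A : Matrix (Fin k) (Fin k) ℝ) (d : Dual T k) (x : L2 T k) :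
    solOp hT A d = x ↔ x = primL2 hT k (d + inlDual T k (matL2 T A x)) := by
  change (volterraEquiv hT A).symm (primL2 hT k d) = x ↔ _
  rw [ContinuousLinearEquiv.symm_apply_eq, map_add]
  change _ = x - volterra hT A x ↔ _
  rw [eq_sub_iff_add_eq]
  exact eq_comm

theorem isSolutionOp_constraintOp (hT : 0 < T) {n m : ℕ} (A : Matrix (Fin n) (Fin n) ℝ)
    (B : Matrix (Fin n) (Fin m) ℝ) :
    IsSolutionOp (constraintOp hT A B) (solOp hT A) (inlDual T n ∘L matL2 T B) := by
  -- `S d` is a primitive, which identifies its weak derivative and its initial value.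
  have hfix : ∀ d : Dual T n,
      primL2 hT n (d + inlDual T n (matL2 T A (solOp hT A d))) = solOp hT A d := fun d =>
    ((solOp_eq_iff hT A d _).1 rfl).symm
  have hH1 : ∀ d : Dual T n, solOp hT A d ∈ H1 T n := fun d => by
    rw [← hfix d]; exact primL2_mem_H1 hT _
  have hval : ∀ d : Dual T n, weakDeriv T n ⟨_, hH1 d⟩ = d.fst + matL2 T A (solOp hT A d) ∧
      initVal hT n ⟨_, hH1 d⟩ = d.snd := fun d => by
    have e : (⟨_, hH1 d⟩ : H1 T n) = ⟨_, primL2_mem_H1 hT _⟩ := Subtype.ext (hfix d).symm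
    rw [e, weakDeriv_primL2, initVal_primL2]
    exact ⟨rfl, add_zero d.snd⟩
  refine ⟨fun z => ?_, fun d u => hH1 d, fun d u => ?_⟩
  · rw [solOp_eq_iff]
    refine (primL2_weakDeriv hT ⟨z.1.fst, z.2⟩).symm.trans (congrArg _ ?_)
    refine WithLp.ofLp_injective 2 (Prod.ext ?_ ?_)
    · change _ = (weakDeriv T n ⟨z.1.fst, z.2⟩ - matL2 T A z.1.fst - matL2 T B z.1.snd)
        + matL2 T B z.1.snd + matL2 T A z.1.fst
      abel_nf
    · change _ = initVal hT n ⟨z.1.fst, z.2⟩ + 0 + 0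
      simp
  · refine WithLp.ofLp_injective 2 (Prod.ext ?_ ?_)
    · change weakDeriv T n ⟨_, hH1 d⟩ - matL2 T A (solOp hT A d) - matL2 T B u
        = d.fst - matL2 T B u
      rw [(hval d).1, add_sub_cancel_right]
    · change initVal hT n ⟨_, hH1 d⟩ = d.snd - 0
      rw [(hval d).2, sub_zero]

end SolutionOperator

/-! ### The cost functional and its gradient -/

section Cost

variable {T : ℝ} {n m : ℕ}

/-- The state cost `Φ(x) = ∫₀ᵀ ℓ(x(τ)) dτ`. -/
def stateCost (T : ℝ) {n : ℕ} (ℓ : E n → ℝ) (x : L2 T n) : ℝ := ∫ t in Icc 0 T, ℓ (x t)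

theorem convexOn_stateCost {ℓ : E n → ℝ} (hℓ : ConvexOn ℝ univ ℓ)
    (hint : ∀ x : L2 T n, Integrable (fun t => ℓ (x t)) (vol T)) :
    ConvexOn ℝ univ (stateCost T ℓ) := by
  refine ⟨convex_univ, fun x _ y _ a b ha hb hab => ?_⟩
  simp only [stateCost, smul_eq_mul]
  rw [← integral_const_mul, ← integral_const_mul,
    ← integral_add ((hint x).const_mul a) ((hint y).const_mul b)]
  refine integral_mono_ae (hint _) (((hint x).const_mul a).add ((hint y).const_mul b)) ?_
  filter_upwards [Lp.coeFn_add (a • x) (b • y), Lp.coeFn_smul a x, Lp.coeFn_smul b y]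
    with t h1 h2 h3
  rw [h1, Pi.add_apply, h2, h3]
  exact hℓ.2 (mem_univ (x t)) (mem_univ (y t)) ha hb hab

theorem cost_eq {ℓ : E n → ℝ} (hint : ∀ x : L2 T n, Integrable (fun t => ℓ (x t)) (vol T))
    (α : ℝ) (x : L2 T n) (u : L2 T m) :
    cost ℓ α x u = stateCost T ℓ x + α / 2 * ‖u‖ ^ 2 := by
  have h1 : ‖u‖ ^ 2 = ∫ t in Icc 0 T, ‖u t‖ ^ 2 := by
    rw [← real_inner_self_eq_norm_sq, L2.inner_def]
    simp only [real_inner_self_eq_norm_sq]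
  rw [cost, integral_add (hint x) (((Lp.memLp u).integrable_norm_pow (by simp)).const_mul _),
    integral_const_mul, h1, stateCost]

theorem costGrad_eq {ℓ : E n → ℝ} (hint : ∀ x : L2 T n, Integrable (fun t => ℓ (x t)) (vol T))
    (hdiff : Differentiable ℝ (stateCost T ℓ)) (α : ℝ) (z : Primal T n m) :
    costGrad ℓ α z = WithLp.toLp 2 (gradient (stateCost T ℓ) z.fst, α • z.snd) := by
  have h1 : HasGradientAt (fun x : L2 T n => cost ℓ α x z.snd)
      (gradient (stateCost T ℓ) z.fst) z.fst := by
    simp only [cost_eq hint]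
    exact hasGradientAt_iff_hasFDerivAt.2
      ((hdiff z.fst).hasGradientAt.hasFDerivAt.add_const (α / 2 * ‖z.snd‖ ^ 2))
  have h2 : HasGradientAt (fun u : L2 T m => cost ℓ α z.fst u) (α • z.snd) z.snd := by
    simp only [cost_eq hint]
    rw [hasGradientAt_iff_hasFDerivAt]
    refine (((hasStrictFDerivAt_norm_sq z.snd).hasFDerivAt.const_mul (α / 2)).const_add
      (stateCost T ℓ z.fst)).congr_fderiv ?_
    ext y
    simp
    ring
  rw [costGrad, h1.gradient, h2.gradient]

/-- The gradient inequality for the cost, with the quadratic gap in the control. -/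
theorem cost_add_le {ℓ : E n → ℝ} (hℓ : ConvexOn ℝ univ ℓ)
    (hint : ∀ x : L2 T n, Integrable (fun t => ℓ (x t)) (vol T))
    (hdiff : Differentiable ℝ (stateCost T ℓ)) (α : ℝ) (z w : Primal T n m) :
    cost ℓ α z.fst z.snd + ⟪costGrad ℓ α z, w - z⟫_ℝ + α / 2 * ‖w.snd - z.snd‖ ^ 2
      ≤ cost ℓ α w.fst w.snd := by
  have h1 := add_inner_gradient_le (convexOn_stateCost hℓ hint)
    (hdiff z.fst).hasGradientAt w.fst
  rw [costGrad_eq hint hdiff, WithLp.prod_inner_apply, cost_eq hint, cost_eq hint]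
  change _ + (⟪gradient (stateCost T ℓ) z.fst, w.fst - z.fst⟫_ℝ
    + ⟪α • z.snd, w.snd - z.snd⟫_ℝ) + _ ≤ _
  rw [norm_sub_sq_real, real_inner_smul_left, inner_sub_right z.snd, real_inner_self_eq_norm_sq,
    real_inner_comm w.snd z.snd]
  linarith

/-- The gradient of the cost is monotone, strongly so in the control. -/
theorem le_inner_costGrad_sub {ℓ : E n → ℝ} (hℓ : ConvexOn ℝ univ ℓ)
    (hint : ∀ x : L2 T n, Integrable (fun t => ℓ (x t)) (vol T))
    (hdiff : Differentiable ℝ (stateCost T ℓ)) (α : ℝ) (z w : Primal T n m) :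
    α * ‖z.snd - w.snd‖ ^ 2 ≤ ⟪costGrad ℓ α z - costGrad ℓ α w, z - w⟫_ℝ := by
  have h1 := cost_add_le hℓ hint hdiff α z w
  have h2 := cost_add_le hℓ hint hdiff α w z
  rw [← neg_sub z w, inner_neg_right, norm_sub_rev] at h1
  rw [inner_sub_left]
  linarith

end Cost

/-! ### The operator of the optimality system -/

section KKT

variable {T : ℝ} {hT : 0 < T} {n m : ℕ} {A : Matrix (Fin n) (Fin n) ℝ}
  {B : Matrix (Fin n) (Fin m) ℝ} {ℓ : E n → ℝ} {α : ℝ}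

/-- The skew-symmetric part `(-C* λ, C z)` drops out of the monotonicity of the KKT operator. -/
theorem inner_kktOp_sub (p q : kktDomain hT A B) :
    ⟪kktOp hT A B ℓ α p - kktOp hT A B ℓ α q, p.1 - q.1⟫_ℝ
      = ⟪costGrad ℓ α p.1.fst - costGrad ℓ α q.1.fst, p.1.fst - q.1.fst⟫_ℝ := by
  set C := constraintOp hT A B
  set z : C.domain := ⟨p.1.fst, p.2.1⟩ - ⟨q.1.fst, q.2.1⟩ with hz
  set l : C†.domain := ⟨p.1.snd, p.2.2⟩ - ⟨q.1.snd, q.2.2⟩ with hl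
  have h := LinearPMap.adjoint_isFormalAdjoint (dense_domain_constraintOp hT A B) l z
  rw [WithLp.prod_inner_apply]
  change ⟪(costGrad ℓ α p.1.fst - C† ⟨p.1.snd, p.2.2⟩)
      - (costGrad ℓ α q.1.fst - C† ⟨q.1.snd, q.2.2⟩), (z : Primal T n m)⟫_ℝ
    + ⟪C ⟨p.1.fst, p.2.1⟩ - C ⟨q.1.fst, q.2.1⟩, (l : Dual T n)⟫_ℝ = _
  rw [← C.map_sub, sub_sub_sub_comm, ← (C†).map_sub, ← hz, ← hl, inner_sub_left, h,
    real_inner_comm (l : Dual T n)]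
  change ⟪_, p.1.fst - q.1.fst⟫_ℝ - _ + _ = _
  ring

variable (hℓ : ConvexOn ℝ univ ℓ)
  (hint : ∀ x : L2 T n, Integrable (fun t => ℓ (x t)) (vol T))
  (hdiff : Differentiable ℝ (stateCost T ℓ))

include hℓ hint hdiff

/-- Sufficiency of the optimality system: the multiplier annihilates the first-order term among
feasible competitors, which leaves the quadratic gap in the control. -/
theorem cost_add_le_of_kkt {d : Dual T n} {z w : (constraintOp hT A B).domain}
    {l : ((constraintOp hT A B)†).domain}
    (hgrad : costGrad ℓ α z.1 = (constraintOp hT A B)† l)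
    (hz : constraintOp hT A B z = d) (hw : constraintOp hT A B w = d) :
    cost ℓ α z.1.fst z.1.snd + α / 2 * ‖w.1.snd - z.1.snd‖ ^ 2 ≤ cost ℓ α w.1.fst w.1.snd := by
  have h1 := cost_add_le hℓ hint hdiff α z.1 w.1
  have h2 := LinearPMap.adjoint_isFormalAdjoint (dense_domain_constraintOp hT A B) l (w - z)
  rw [LinearPMap.map_sub, hw, hz, sub_self, inner_zero_right, ← hgrad] at h2
  change ⟪costGrad ℓ α z.1, w.1 - z.1⟫_ℝ = 0 at h2
  linarith

variable (hα : 0 < α)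

include hα

theorem surjective_smul_add_kktOp {μ : ℝ} (hμ : 0 ≤ μ) :
    Function.Surjective fun p : kktDomain hT A B => μ • p.1 + kktOp hT A B ℓ α p := by
  intro r
  obtain ⟨z, l, h1, h2, h3⟩ := (isSolutionOp_constraintOp hT A B).exists_kkt
    (dense_domain_constraintOp hT A B) (fun x => (hdiff x).hasGradientAt)
    (convexOn_stateCost hℓ hint) hα hμ r.fst.fst r.fst.snd r.snd
  refine ⟨⟨WithLp.toLp 2 (z.1, l.1), z.2, l.2⟩, ?_⟩
  simp only [kktOp, costGrad_eq hint hdiff]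
  exact WithLp.ofLp_injective 2 (Prod.ext (WithLp.ofLp_injective 2 (Prod.ext h1 h2)) h3)

theorem injective_kktOp : Function.Injective (kktOp hT A B ℓ α) := by
  intro p q hpq
  have hS := isSolutionOp_constraintOp hT A B
  have h1 : costGrad ℓ α p.1.fst - (constraintOp hT A B)† ⟨p.1.snd, p.2.2⟩
      = costGrad ℓ α q.1.fst - (constraintOp hT A B)† ⟨q.1.snd, q.2.2⟩ :=
    congrArg WithLp.fst hpq
  have h2 : constraintOp hT A B ⟨p.1.fst, p.2.1⟩ = constraintOp hT A B ⟨q.1.fst, q.2.1⟩ :=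
    congrArg WithLp.snd hpq
  -- Strong monotonicity in the control identifies the controls, then the states, then the
  -- multipliers.
  have h3 := inner_kktOp_sub (ℓ := ℓ) (α := α) p q
  rw [hpq, sub_self, inner_zero_left] at h3
  have h4 := le_inner_costGrad_sub hℓ hint hdiff α p.1.fst q.1.fst
  rw [← h3] at h4
  have h5 : ‖p.1.fst.snd - q.1.fst.snd‖ ^ 2 = 0 :=
    le_antisymm (nonpos_of_mul_nonpos_right h4 hα) (sq_nonneg _)
  have h6 : p.1.fst.snd = q.1.fst.snd :=
    sub_eq_zero.1 (norm_eq_zero.1 ((pow_eq_zero_iff two_ne_zero).1 h5))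
  have h7 : p.1.fst = q.1.fst := congrArg Subtype.val (hS.eq_of_snd_eq h2 h6)
  rw [congrArg (costGrad ℓ α) h7, sub_right_inj] at h1
  have h8 : p.1.snd = q.1.snd :=
    congrArg Subtype.val (hS.adjoint_injective (dense_domain_constraintOp hT A B) h1)
  exact Subtype.ext (WithLp.ofLp_injective 2 (Prod.ext h7 h8))

theorem bijective_kktOp : Function.Bijective (kktOp hT A B ℓ α) := by
  refine ⟨injective_kktOp hℓ hint hdiff hα, fun r => ?_⟩
  obtain ⟨p, hp⟩ := surjective_smul_add_kktOp (hT := hT) (A := A) (B := B) hℓ hint hdiff hα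
    le_rfl r
  exact ⟨p, by simpa using hp⟩

theorem isMAccretive_kktOp : IsMAccretive (kktOp hT A B ℓ α) :=
  ⟨fun p q => by
    rw [inner_kktOp_sub]
    exact le_trans (by positivity) (le_inner_costGrad_sub hℓ hint hdiff α p.1.fst q.1.fst),
    fun _ hlam => surjective_smul_add_kktOp hℓ hint hdiff hα hlam.le⟩

end KKT

end OptCtrl

end

theorem proposition3p4 {T : ℝ} (hT : 0 < T) {n m : ℕ}
    (A : Matrix (Fin n) (Fin n) ℝ) (B : Matrix (Fin n) (Fin m) ℝ)
    (f : L2 T n) (x₀ : E n) (α : ℝ) (hα : 0 < α)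
    (ℓ : E n → ℝ) (hℓ_nonneg : ∀ v, 0 ≤ ℓ v) (hℓ_cont : Continuous ℓ)
    (hℓ_convex : ConvexOn ℝ Set.univ ℓ)
    (hℓ_int : ∀ x : L2 T n, Integrable (fun t => ℓ (x t)) (vol T))
    (hℓ_diff : Differentiable ℝ (fun x : L2 T n => ∫ t in Set.Icc 0 T, ℓ (x t))) :
    -- a unique optimal solution, which solves the KKT system with some multiplier
    (∃ z : (constraintOp hT A B).domain, IsOptimal hT A B ℓ α f x₀ z ∧
      (∀ w, IsOptimal hT A B ℓ α f x₀ w → w = z) ∧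
      ∃ lam : ((constraintOp hT A B)†).domain,
        kktOp hT A B ℓ α ⟨WithLp.toLp 2 (z.1, lam.1), z.2, lam.2⟩ =
          WithLp.toLp 2 (0, WithLp.toLp 2 (f, x₀))) ∧
    -- the KKT operator is bijective and m-accretive
    Function.Bijective (kktOp hT A B ℓ α) ∧
    IsMAccretive (kktOp hT A B ℓ α) ∧
    -- the solution of the KKT system is unique
    (∃! p : kktDomain hT A B,
      kktOp hT A B ℓ α p = WithLp.toLp 2 (0, WithLp.toLp 2 (f, x₀))) := by
  have hbij := bijective_kktOp (hT := hT) (A := A) (B := B) hℓ_convex hℓ_int hℓ_diff hα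
  refine ⟨?_, hbij, isMAccretive_kktOp hℓ_convex hℓ_int hℓ_diff hα, hbij.existsUnique _⟩
  obtain ⟨p, hp⟩ := hbij.2 (WithLp.toLp 2 (0, WithLp.toLp 2 (f, x₀)))
  have h1 : costGrad ℓ α p.1.fst - (constraintOp hT A B)† ⟨p.1.snd, p.2.2⟩ = 0 :=
    congrArg WithLp.fst hp
  have h2 : constraintOp hT A B ⟨p.1.fst, p.2.1⟩ = WithLp.toLp 2 (f, x₀) :=
    congrArg WithLp.snd hp
  have key := fun (w : (constraintOp hT A B).domain) hw =>
    cost_add_le_of_kkt hℓ_convex hℓ_int hℓ_diff (w := w) (z := ⟨p.1.fst, p.2.1⟩)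
      (sub_eq_zero.1 h1) h2 hw
  refine ⟨⟨p.1.fst, p.2.1⟩, ⟨h2, fun w hw => ?_⟩, fun w hw => ?_, ⟨p.1.snd, p.2.2⟩, hp⟩
  · exact le_trans (le_add_of_nonneg_right (by positivity)) (key w hw)
  · refine (isSolutionOp_constraintOp hT A B).eq_of_snd_eq (hw.1.trans h2.symm) ?_
    have h3 := (key w hw.1).trans (hw.2 ⟨p.1.fst, p.2.1⟩ h2)
    have h4 : ‖w.1.snd - p.1.fst.snd‖ ^ 2 = 0 :=
      le_antisymm (nonpos_of_mul_nonpos_right (by linarith) (half_pos hα)) (sq_nonneg _)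
    exact sub_eq_zero.1 (norm_eq_zero.1 ((pow_eq_zero_iff two_ne_zero).1 h4))
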